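/- Let $\Bbbk=\mathbb{R}$ or $\mathbb{C}$, with $\langle x,y\rangle=x^*y$ and the Euclidean norm on $\Bbbk^d$, and let $\mathbb{S}^n(\Bbbk)$ be the set of $n\times n$ matrices $A=(a_{ij})$ over $\Bbbk$ with $A^*=A$. For $A\in\mathbb{S}^n(\Bbbk)$ define $$q_{=}(A)=\max\{x^*Ax : x\in\Bbbk^n,\ |x_i|=1 \text{ for all } i\},\qquad q_{\le}(A)=\max\{x^*Ax : x\in\Bbbk^n,\ |x_i|\le 1 \text{ for all } i\},$$ $$r_{=}(A)=\max\{\operatorname{tr}(AX) : X\in\mathbb{S}^n(\Bbbk),\ X\succeq 0,\ x_{ii}=1 \text{ for all } i\},\qquad r_{\le}(A)=\max\{\operatorname{tr}(AX) : X\in\mathbb{S}^n(\Bbbk),\ X\succeq 0,\ x_{ii}\le 1 \text{ for all } i\}.$$ Let $K_\gamma^{\Bbbk}$ be the smallest constant $K$ such that $$\max_{\|x_i\|=1}\Bigl|\sum_{i,j=1}^n a_{ij}\langle x_i,x_j\rangle\Bigr|\le K\max_{|\delta_i|=1}\Bigl|\sum_{i,j=1}^n a_{ij}\bar\delta_i\delta_j\Bigr|$$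 for all $n$, all $d\ge n$ and all $A\in\mathbb{S}^n(\Bbbk)$, where the maxima are over $x_1,\dots,x_n\in\Bbbk^d$ and $\delta_1,\dots,\delta_n\in\Bbbk$; and let $K_\Gamma^{\Bbbk}$ be the smallest constant $K$ such that the same holds with $\|x_i\|=1$ and $|\delta_i|=1$ replaced by $\|x_i\|\le1$ and $|\delta_i|\le1$. Then for all $n\in\mathbb{N}$ and all $A\in\mathbb{S}^n(\Bbbk)$, $$\max\{q_{=}(A),q_{=}(-A)\}\le\max\{r_{=}(A),r_{=}(-A)\}\le K_\gamma^{\Bbbk}\max\{q_{=}(A),q_{=}(-A)\},$$ $$\max\{q_{\le}(A),q_{\le}(-A)\}\le\max\{r_{\le}(A),r_{\le}(-A)\}\le K_\Gamma^{\Bbbk}\max\{q_{\le}(A),q_{\le}(-A)\}.$$ Moreover, the constants are sharp: $K_\gamma^{\Bbbk}$ and $K_\Gamma^{\Bbbk}$ are the smallest constants for which the right-hand inequality in the first line, respectively the second line, holds for all $n$ and all $A\in\mathbb{S}^n(\Bbbk)$. -/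

import Mathlib

open scoped ComplexOrder

namespace SymGrothendieck

noncomputable section

variable {𝕜 : Type*} [RCLike 𝕜] {n : ℕ}

/-! All maxima below are written as suprema of nonempty compact (for `n ≤ d`) sets of reals. -/

/-- The seminorm `‖A‖_γ`, computed with vectors in `𝕜^d`: the maximum of
`|∑ i, ∑ j, a_ij ⟨x_i, x_j⟩|` over unit vectors `x_1, …, x_n ∈ 𝕜^d`. -/
def gammaNorm (d : ℕ) (A : Matrix (Fin n) (Fin n) 𝕜) : ℝ :=
  sSup {t : ℝ | ∃ x : Fin n → EuclideanSpace 𝕜 (Fin d), (∀ i, ‖x i‖ = 1) ∧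
    t = ‖∑ i, ∑ j, A i j * inner 𝕜 (x i) (x j)‖}

/-- The norm `‖A‖_Γ`, computed with vectors in `𝕜^d`: the maximum of
`|∑ i, ∑ j, a_ij ⟨x_i, x_j⟩|` over `x_1, …, x_n` in the closed unit ball of `𝕜^d`. -/
def GammaNorm (d : ℕ) (A : Matrix (Fin n) (Fin n) 𝕜) : ℝ :=
  sSup {t : ℝ | ∃ x : Fin n → EuclideanSpace 𝕜 (Fin d), (∀ i, ‖x i‖ ≤ 1) ∧
    t = ‖∑ i, ∑ j, A i j * inner 𝕜 (x i) (x j)‖}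

/-- The seminorm `‖A‖_θ`: the maximum of `|∑ i, ∑ j, a_ij conj(δ_i) δ_j|` over `|δ_i| = 1`. -/
def thetaNorm (A : Matrix (Fin n) (Fin n) 𝕜) : ℝ :=
  sSup {t : ℝ | ∃ δ : Fin n → 𝕜, (∀ i, ‖δ i‖ = 1) ∧
    t = ‖∑ i, ∑ j, A i j * (star (δ i) * δ j)‖}

/-- The norm `‖A‖_Θ`: the maximum of `|∑ i, ∑ j, a_ij conj(δ_i) δ_j|` over `|δ_i| ≤ 1`. -/
def ThetaNorm (A : Matrix (Fin n) (Fin n) 𝕜) : ℝ :=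
  sSup {t : ℝ | ∃ δ : Fin n → 𝕜, (∀ i, ‖δ i‖ ≤ 1) ∧
    t = ‖∑ i, ∑ j, A i j * (star (δ i) * δ j)‖}

variable (𝕜) in
/-- The symmetric Grothendieck constant `K_γ` over `𝕜`: the smallest `K` such that
`‖A‖_γ ≤ K ‖A‖_θ` for all `n`, all `d ≥ n` and all symmetric/Hermitian `n × n` matrices `A`. -/
def Kgamma : ℝ :=
  sInf {K : ℝ | ∀ n d : ℕ, n ≤ d → ∀ A : Matrix (Fin n) (Fin n) 𝕜, A.IsHermitian →
    gammaNorm d A ≤ K * thetaNorm A}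

variable (𝕜) in
/-- The symmetric Grothendieck constant `K_Γ` over `𝕜`: the smallest `K` such that
`‖A‖_Γ ≤ K ‖A‖_Θ` for all `n`, all `d ≥ n` and all symmetric/Hermitian `n × n` matrices `A`. -/
def KGamma : ℝ :=
  sInf {K : ℝ | ∀ n d : ℕ, n ≤ d → ∀ A : Matrix (Fin n) (Fin n) 𝕜, A.IsHermitian →
    GammaNorm d A ≤ K * ThetaNorm A}

/-- `q_=(A)`: the maximum of `x* A x` over vectors `x` with `|x_i| = 1` for all `i`.
(For Hermitian `A` the number `x* A x` is real, so taking the real part only changes its type.) -/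
def qEq (A : Matrix (Fin n) (Fin n) 𝕜) : ℝ :=
  sSup {t : ℝ | ∃ x : Fin n → 𝕜, (∀ i, ‖x i‖ = 1) ∧
    t = RCLike.re (star x ⬝ᵥ A.mulVec x)}

/-- `q_≤(A)`: the maximum of `x* A x` over vectors `x` with `|x_i| ≤ 1` for all `i`. -/
def qLe (A : Matrix (Fin n) (Fin n) 𝕜) : ℝ :=
  sSup {t : ℝ | ∃ x : Fin n → 𝕜, (∀ i, ‖x i‖ ≤ 1) ∧
    t = RCLike.re (star x ⬝ᵥ A.mulVec x)}

/-- `r_=(A)`: the maximum of `tr(AX)` over positive semidefinite `X` with `x_ii = 1` for all `i`.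
(For Hermitian `A`, `X` the number `tr(AX)` is real.) -/
def rEq (A : Matrix (Fin n) (Fin n) 𝕜) : ℝ :=
  sSup {t : ℝ | ∃ X : Matrix (Fin n) (Fin n) 𝕜, X.PosSemidef ∧ (∀ i, X i i = 1) ∧
    t = RCLike.re (A * X).trace}

/-- `r_≤(A)`: the maximum of `tr(AX)` over positive semidefinite `X` with `x_ii ≤ 1` for all `i`.
(The diagonal of a positive semidefinite matrix is real.) -/
def rLe (A : Matrix (Fin n) (Fin n) 𝕜) : ℝ :=
  sSup {t : ℝ | ∃ X : Matrix (Fin n) (Fin n) 𝕜, X.PosSemidef ∧ (∀ i, RCLike.re (X i i) ≤ 1) ∧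
    t = RCLike.re (A * X).trace}

end

end SymGrothendieck

open SymGrothendieck

namespace SymGrothendieck

open Matrix

section

variable {𝕜 : Type*} [RCLike 𝕜] {n : ℕ}

/-! ### Quadratic form identities and a priori bounds -/

/-- The real part of the quadratic form `x* A x`. -/
noncomputable def quadForm (A : Matrix (Fin n) (Fin n) 𝕜) (x : Fin n → 𝕜) : ℝ :=
  RCLike.re (star x ⬝ᵥ A.mulVec x)

/-- The sum of the quadratic form of `A` over the columns of `U`; this is the real part of
`tr (A U U*)`. -/
noncomputable def gramForm {ι : Type*} [Fintype ι] (A : Matrix (Fin n) (Fin n) 𝕜)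
    (U : Fin n → ι → 𝕜) : ℝ :=
  ∑ ω, quadForm A fun i => U i ω

lemma quadForm_eq_sum (A : Matrix (Fin n) (Fin n) 𝕜) (x : Fin n → 𝕜) :
    quadForm A x = ∑ i, ∑ j, RCLike.re (A i j * (star (x i) * x j)) := by
  simp only [quadForm, dotProduct, mulVec, Finset.mul_sum, map_sum, Pi.star_apply]
  refine Finset.sum_congr rfl fun i _ => Finset.sum_congr rfl fun j _ => ?_
  congr 1; ring

lemma quadForm_neg (A : Matrix (Fin n) (Fin n) 𝕜) (x : Fin n → 𝕜) :
    quadForm (-A) x = -quadForm A x := by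
  simp [quadForm, neg_mulVec]

lemma quadForm_sub (A B : Matrix (Fin n) (Fin n) 𝕜) (x : Fin n → 𝕜) :
    quadForm (A - B) x = quadForm A x - quadForm B x := by
  simp [quadForm, sub_mulVec]

lemma quadForm_smul (A : Matrix (Fin n) (Fin n) 𝕜) (c : ℝ) (x : Fin n → 𝕜) :
    quadForm A (fun i => (c : 𝕜) * x i) = c ^ 2 * quadForm A x := by
  simp only [quadForm_eq_sum, Finset.mul_sum]
  refine Finset.sum_congr rfl fun i _ => Finset.sum_congr rfl fun j _ => ?_
  have : A i j * (star ((c : 𝕜) * x i) * ((c : 𝕜) * x j))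
      = ((c ^ 2 : ℝ) : 𝕜) * (A i j * (star (x i) * x j)) := by
    simp; ring
  rw [this, RCLike.re_ofReal_mul]

lemma quadForm_convex_combination (A : Matrix (Fin n) (Fin n) 𝕜) (a b : ℝ) (hab : a + b = 1)
    (x y : Fin n → 𝕜) :
    quadForm A (fun i => (a : 𝕜) * x i + (b : 𝕜) * y i)
      = a * quadForm A x + b * quadForm A y - a * b * quadForm A (fun i => x i - y i) := by
  obtain rfl : b = 1 - a := by linarith
  simp only [quadForm_eq_sum, Finset.mul_sum, ← Finset.sum_add_distrib, ← Finset.sum_sub_distrib]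
  refine Finset.sum_congr rfl fun i _ => Finset.sum_congr rfl fun j _ => ?_
  simp only [← RCLike.re_ofReal_mul, ← map_add, ← map_sub]
  congr 1
  simp
  ring

/-- Polarization with unequal weights: the cross terms of `t` and `r` are recovered from `t / 8 ±
r`, which have small second moments when those of `r` are small. No symmetry of `A` is needed. -/
lemma quadForm_add_split (A : Matrix (Fin n) (Fin n) 𝕜) (t r : Fin n → 𝕜) :
    quadForm A (fun i => t i + r i) = quadForm A t + quadForm A r
      + 4 * (quadForm A (fun i => ((1 / 8 : ℝ) : 𝕜) * t i + r i)
        - quadForm A (fun i => ((1 / 8 : ℝ) : 𝕜) * t i - r i)) := by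
  simp only [quadForm_eq_sum, Finset.mul_sum, ← Finset.sum_add_distrib, ← Finset.sum_sub_distrib]
  refine Finset.sum_congr rfl fun i _ => Finset.sum_congr rfl fun j _ => ?_
  have h4 : ∀ z : 𝕜, 4 * RCLike.re z = RCLike.re (((4 : ℝ) : 𝕜) * z) := fun z => by
    rw [RCLike.re_ofReal_mul]
  simp only [← map_add, ← map_sub, h4]
  congr 1
  have h48 : ((4 : ℝ) : 𝕜) * ((1 / 8 : ℝ) : 𝕜) = ((1 / 2 : ℝ) : 𝕜) := by
    rw [← RCLike.ofReal_mul]; norm_num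
  have h2 : ((1 / 2 : ℝ) : 𝕜) * 2 = 1 := by
    rw [RCLike.ofReal_div, RCLike.ofReal_one, RCLike.ofReal_ofNat]; norm_num
  simp only [star_add, star_sub, star_mul, RCLike.star_def, RCLike.conj_ofReal]
  linear_combination (-2 * A i j * (starRingEnd 𝕜 (t i) * r j + starRingEnd 𝕜 (r i) * t j)) * h48
    - (A i j * (starRingEnd 𝕜 (t i) * r j + starRingEnd 𝕜 (r i) * t j)) * h2

lemma abs_quadForm_le (A : Matrix (Fin n) (Fin n) 𝕜) (x : Fin n → 𝕜) :
    |quadForm A x| ≤ ∑ i, ∑ j, ‖A i j‖ * ((‖x i‖ ^ 2 + ‖x j‖ ^ 2) / 2) := by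
  rw [quadForm_eq_sum]
  refine (Finset.abs_sum_le_sum_abs _ _).trans (Finset.sum_le_sum fun i _ =>
    (Finset.abs_sum_le_sum_abs _ _).trans (Finset.sum_le_sum fun j _ =>
      (RCLike.abs_re_le_norm _).trans ?_))
  rw [norm_mul, norm_mul, norm_star]
  gcongr
  nlinarith [sq_nonneg (‖x i‖ - ‖x j‖)]

/-- A crude bound, independent of `ι`; its role is to make the suprema finite, so that a multiple of
one can be absorbed. -/
lemma abs_gramForm_le {ι : Type*} [Fintype ι] (A : Matrix (Fin n) (Fin n) 𝕜) (U : Fin n → ι → 𝕜)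
    (hU : ∀ i, ∑ ω, ‖U i ω‖ ^ 2 ≤ 1) : |gramForm A U| ≤ ∑ i, ∑ j, ‖A i j‖ := by
  calc |gramForm A U| ≤ ∑ ω, ∑ i, ∑ j, ‖A i j‖ * ((‖U i ω‖ ^ 2 + ‖U j ω‖ ^ 2) / 2) :=
        (Finset.abs_sum_le_sum_abs _ _).trans (Finset.sum_le_sum fun ω _ => abs_quadForm_le A _)
    _ = ∑ i, ∑ j, ‖A i j‖ * ((∑ ω, ‖U i ω‖ ^ 2 + ∑ ω, ‖U j ω‖ ^ 2) / 2) := by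
        rw [Finset.sum_comm]
        refine Finset.sum_congr rfl fun i _ => ?_
        rw [Finset.sum_comm]
        refine Finset.sum_congr rfl fun j _ => ?_
        rw [← Finset.mul_sum, ← Finset.sum_div, Finset.sum_add_distrib]
    _ ≤ ∑ i, ∑ j, ‖A i j‖ := by
        refine Finset.sum_le_sum fun i _ => Finset.sum_le_sum fun j _ => ?_
        have := hU i
        have := hU j
        exact mul_le_of_le_one_right (norm_nonneg _) (by linarith)

lemma abs_gramForm_le_mul {ι : Type*} [Fintype ι] {A : Matrix (Fin n) (Fin n) 𝕜} {C : ℝ}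
    (hC : ∀ U : Fin n → ι → 𝕜, (∀ i, ∑ ω, ‖U i ω‖ ^ 2 ≤ 1) → |gramForm A U| ≤ C)
    {s : ℝ} (hs : 0 < s) (U : Fin n → ι → 𝕜) (hU : ∀ i, ∑ ω, ‖U i ω‖ ^ 2 ≤ s) :
    |gramForm A U| ≤ s * C := by
  have hc : ((√s)⁻¹) ^ 2 = s⁻¹ := by rw [inv_pow, Real.sq_sqrt hs.le]
  have h := hC (fun i ω => (((√s)⁻¹ : ℝ) : 𝕜) * U i ω) fun i => by
    simp only [norm_mul, mul_pow, RCLike.norm_ofReal, sq_abs, hc, ← Finset.mul_sum]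
    rw [inv_mul_le_iff₀ hs]; simpa using hU i
  simp only [gramForm, quadForm_smul, hc, ← Finset.mul_sum] at h
  rwa [abs_mul, abs_of_pos (inv_pos.2 hs), inv_mul_le_iff₀ hs] at h

/-! ### Random signs -/

/-- Random signs: orthogonality and Khinchin's fourth moment inequality. -/
lemma exists_signs (𝕜 : Type*) [RCLike 𝕜] (d : ℕ) :
    ∃ (Ω : Type) (_ : Fintype Ω) (_ : Nonempty Ω) (e : Fin d → Ω → 𝕜),
      (∀ k ω, ‖e k ω‖ = 1) ∧
      (∀ k l, ∑ ω, e k ω * star (e l ω) = if k = l then (Fintype.card Ω : 𝕜) else 0) ∧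
      ∀ x : Fin d → 𝕜,
        ∑ ω, ‖∑ k, x k * e k ω‖ ^ 2 = Fintype.card Ω * ∑ k, ‖x k‖ ^ 2 ∧
        ∑ ω, ‖∑ k, x k * e k ω‖ ^ 4 ≤ 3 * Fintype.card Ω * (∑ k, ‖x k‖ ^ 2) ^ 2 := by
  induction d with
  | zero =>
    refine ⟨Unit, inferInstance, inferInstance, fun k => k.elim0, fun k => k.elim0,
      fun k => k.elim0, fun x => by simp⟩
  | succ d ih =>
    obtain ⟨Ω, _, _, e, h1, h2, h3⟩ := ih
    -- The new `Bool` factor carries an independent sign for the added coordinate.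
    let s : Bool → 𝕜 := fun b => if b then 1 else -1
    refine ⟨Ω × Bool, inferInstance, inferInstance,
      fun k ω => Fin.cases (s ω.2) (fun k => e k ω.1) k, ?_, ?_, ?_⟩
    · intro k ω
      refine Fin.cases ?_ (fun k => ?_) k
      · rcases ω with ⟨ω, _ | _⟩ <;> simp [s]
      · exact h1 k _
    · intro k l
      rw [Fintype.sum_prod_type]
      refine Fin.cases ?_ (fun k => ?_) k <;> refine Fin.cases ?_ (fun l => ?_) l
      · simp [s]; ring
      · simp [s, (Fin.succ_ne_zero _).symm]
      · simp [s, Fin.succ_ne_zero]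
      · simp only [Fin.cases_succ, Fintype.univ_bool]
        have := h2 k l
        simp only [Finset.sum_const, Finset.card_pair (show true ≠ false by decide),
          ← Finset.smul_sum, this, Fintype.card_prod, Fintype.card_bool, Fin.succ_inj]
        split_ifs <;> simp [mul_comm]
    · intro x
      obtain ⟨h4, h5⟩ := h3 fun k => x k.succ
      set S : Ω → 𝕜 := fun ω => ∑ k, x k.succ * e k ω with hS
      change ∑ ω, ‖S ω‖ ^ 2 = _ at h4
      change ∑ ω, ‖S ω‖ ^ 4 ≤ _ at h5
      have key : ∀ a b : 𝕜, ‖b + a‖ ^ 2 = ‖a‖ ^ 2 + 2 * RCLike.re (inner 𝕜 a b) + ‖b‖ ^ 2 ∧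
          ‖-b + a‖ ^ 2 = ‖a‖ ^ 2 - 2 * RCLike.re (inner 𝕜 a b) + ‖b‖ ^ 2 := fun a b =>
        ⟨by rw [add_comm, norm_add_sq (𝕜 := 𝕜)],
          by rw [neg_add_eq_sub, norm_sub_sq (𝕜 := 𝕜)]⟩
      have hin : ∀ a b : 𝕜, RCLike.re (inner 𝕜 a b) ^ 2 ≤ ‖a‖ ^ 2 * ‖b‖ ^ 2 := fun a b => by
        rw [← mul_pow, ← sq_abs]
        exact pow_le_pow_left₀ (abs_nonneg _)
          ((RCLike.abs_re_le_norm _).trans (norm_inner_le_norm _ _)) 2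
      have hsum : ∀ m : ℕ, ∑ ω : Ω × Bool,
          ‖∑ k : Fin (d + 1), x k * (Fin.cases (s ω.2) (fun k => e k ω.1) k : 𝕜)‖ ^ m
            = ∑ ω, (‖x 0 + S ω‖ ^ m + ‖-x 0 + S ω‖ ^ m) := fun m => by
        rw [Fintype.sum_prod_type]
        simp [Fin.sum_univ_succ, s, hS]
      rw [hsum, hsum, Fin.sum_univ_succ]
      set σ := ∑ k : Fin d, ‖x k.succ‖ ^ 2
      have hσ : 0 ≤ σ := Finset.sum_nonneg fun _ _ => by positivity
      have hN : (Fintype.card (Ω × Bool) : ℝ) = 2 * Fintype.card Ω := by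
        simp [mul_comm]
      rw [hN]
      set N : ℝ := (Fintype.card Ω : ℝ)
      have hN0 : 0 ≤ N := Nat.cast_nonneg _
      constructor
      · calc _ = ∑ ω, (2 * ‖S ω‖ ^ 2 + 2 * ‖x 0‖ ^ 2) := by
              refine Finset.sum_congr rfl fun ω _ => ?_
              rw [(key _ _).1, (key _ _).2]; ring
          _ = 2 * N * (‖x 0‖ ^ 2 + σ) := by
              rw [Finset.sum_add_distrib, ← Finset.mul_sum, h4]
              simp [N]; ring
      · calc _ ≤ ∑ ω, (2 * ‖S ω‖ ^ 4 + 12 * ‖x 0‖ ^ 2 * ‖S ω‖ ^ 2 + 2 * ‖x 0‖ ^ 4) := by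
              refine Finset.sum_le_sum fun ω _ => ?_
              have e4 : ∀ t : ℝ, t ^ 4 = (t ^ 2) ^ 2 := fun t => by ring
              rw [e4 ‖x 0 + S ω‖, e4 ‖-x 0 + S ω‖, (key _ _).1, (key _ _).2]
              -- Odd powers of the inner product cancel between the two signs; Cauchy–Schwarz bounds
              -- its square, producing the coefficient 12.
              nlinarith [hin (S ω) (x 0)]
          _ ≤ 2 * (3 * N * σ ^ 2) + 12 * ‖x 0‖ ^ 2 * (N * σ) + N * (2 * ‖x 0‖ ^ 4) := by
              rw [Finset.sum_add_distrib, Finset.sum_add_distrib, ← Finset.mul_sum,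
                ← Finset.mul_sum, h4]
              simp only [Finset.sum_const, Finset.card_univ, nsmul_eq_mul]
              linarith
          _ ≤ 3 * (2 * N) * (‖x 0‖ ^ 2 + σ) ^ 2 := by
              nlinarith [mul_nonneg hN0 (pow_nonneg (norm_nonneg (x 0)) 4)]

lemma gramForm_eq_sum {ι : Type*} [Fintype ι] (A : Matrix (Fin n) (Fin n) 𝕜) (U : Fin n → ι → 𝕜) :
    gramForm A U = ∑ i, ∑ j, RCLike.re (A i j * ∑ ω, star (U i ω) * U j ω) := by
  simp only [gramForm, quadForm_eq_sum, Finset.mul_sum, map_sum]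
  rw [Finset.sum_comm]
  exact Finset.sum_congr rfl fun i _ => Finset.sum_comm

lemma gramForm_comp_equiv {ι κ : Type*} [Fintype ι] [Fintype κ] (A : Matrix (Fin n) (Fin n) 𝕜)
    (U : Fin n → ι → 𝕜) (σ : κ ≃ ι) : gramForm A (fun i k => U i (σ k)) = gramForm A U :=
  Equiv.sum_comp σ fun ω => quadForm A fun i => U i ω

/-- Orthogonality of the signs makes the passage from `Fin d` to `Ω` an isometry up to the factor
`card Ω`. -/
lemma gramForm_signs {d : ℕ} {Ω : Type*} [Fintype Ω] {e : Fin d → Ω → 𝕜}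
    (he : ∀ k l, ∑ ω, e k ω * star (e l ω) = if k = l then (Fintype.card Ω : 𝕜) else 0)
    (A : Matrix (Fin n) (Fin n) 𝕜) (U : Fin n → Fin d → 𝕜) :
    gramForm A (fun i ω => ∑ k, U i k * e k ω) = Fintype.card Ω * gramForm A U := by
  have h : ∀ i j, ∑ ω, star (∑ k, U i k * e k ω) * ∑ k, U j k * e k ω
      = ((Fintype.card Ω : ℝ) : 𝕜) * ∑ k, star (U i k) * U j k := fun i j => by
    calc _ = ∑ ω, ∑ k, ∑ l, (star (U i k) * U j l) * (e l ω * star (e k ω)) := by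
          refine Finset.sum_congr rfl fun ω _ => ?_
          rw [star_sum, Finset.sum_mul_sum]
          refine Finset.sum_congr rfl fun k _ => Finset.sum_congr rfl fun l _ => ?_
          rw [star_mul]; ring
      _ = ∑ k, ∑ l, (star (U i k) * U j l) * ∑ ω, e l ω * star (e k ω) := by
          rw [Finset.sum_comm]
          refine Finset.sum_congr rfl fun k _ => ?_
          rw [Finset.sum_comm]
          exact Finset.sum_congr rfl fun l _ => (Finset.mul_sum ..).symm
      _ = _ := by
          simp only [he]
          simp [Finset.mul_sum, mul_comm]
  simp only [gramForm_eq_sum, h, Finset.mul_sum (s := Finset.univ) (a := (Fintype.card Ω : ℝ))]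
  refine Finset.sum_congr rfl fun i _ => Finset.sum_congr rfl fun j _ => ?_
  rw [mul_left_comm, RCLike.re_ofReal_mul]

/-! ### Grothendieck's inequality on balls -/

/-- One truncation step: an a priori bound `C` on `gramForm A` improves to `192 c + 17/64 C`. -/
lemma abs_gramForm_le_of_apriori {A : Matrix (Fin n) (Fin n) 𝕜} {c C : ℝ}
    (hc : ∀ x : Fin n → 𝕜, (∀ i, ‖x i‖ ≤ 1) → |quadForm A x| ≤ c)
    (hC : ∀ (ι : Type) [Fintype ι] (U : Fin n → ι → 𝕜), (∀ i, ∑ ω, ‖U i ω‖ ^ 2 ≤ 1) →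
      |gramForm A U| ≤ C)
    {d : ℕ} (U : Fin n → Fin d → 𝕜) (hU : ∀ i, ∑ ω, ‖U i ω‖ ^ 2 ≤ 1) :
    |gramForm A U| ≤ 192 * c + 17 / 64 * C := by
  obtain ⟨Ω, _, _, e, -, he, hx⟩ := exists_signs 𝕜 d
  set N : ℝ := (Fintype.card Ω : ℝ) with hN
  have hN0 : 0 < N := by simp [hN, Fintype.card_pos]
  set S : Fin n → Ω → 𝕜 := fun i ω => ∑ k, U i k * e k ω with hS
  have hS2 : ∀ i, ∑ ω, ‖S i ω‖ ^ 2 ≤ N := fun i => by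
    rw [(hx _).1]; exact mul_le_of_le_one_right hN0.le (hU i)
  have hS4 : ∀ i, ∑ ω, ‖S i ω‖ ^ 4 ≤ 3 * N := fun i =>
    (hx _).2.trans (mul_le_of_le_one_right (by positivity)
      (pow_le_one₀ (Finset.sum_nonneg fun _ _ => by positivity) (hU i)))
  -- The level 192 = 3 · 64 turns the fourth moment bound `3 * N` into a tail of second moment at
  -- most `N / 64`.
  set T : Fin n → Ω → 𝕜 := fun i ω => if ‖S i ω‖ ^ 2 ≤ 192 then S i ω else 0 with hT
  set R : Fin n → Ω → 𝕜 := fun i ω => if ‖S i ω‖ ^ 2 ≤ 192 then 0 else S i ω with hR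
  have hTR : ∀ i ω, S i ω = T i ω + R i ω := fun i ω => by
    simp only [hT, hR]; split_ifs <;> simp
  have hR2 : ∀ i ω, ‖R i ω‖ ^ 2 ≤ ‖S i ω‖ ^ 4 / 192 := fun i ω => by
    simp only [hR]
    split_ifs with h
    · simp; positivity
    · nlinarith [sq_nonneg ‖S i ω‖]
  have hRsum : ∀ i, ∑ ω, ‖R i ω‖ ^ 2 ≤ N / 64 := fun i =>
    (Finset.sum_le_sum fun ω _ => hR2 i ω).trans (by
      rw [← Finset.sum_div]; linarith [hS4 i])
  -- `T i` and `R i` have disjoint supports, so no cross term appears: the bound is `N / 64 + N /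
  -- 64`.
  have hmix : ∀ (a : 𝕜), ‖a‖ = 1 → ∀ i,
      ∑ ω, ‖((1 / 8 : ℝ) : 𝕜) * T i ω + a * R i ω‖ ^ 2 ≤ N / 32 := fun a ha i => by
    have : ∀ ω, ‖((1 / 8 : ℝ) : 𝕜) * T i ω + a * R i ω‖ ^ 2
        ≤ ‖S i ω‖ ^ 2 / 64 + ‖R i ω‖ ^ 2 := fun ω => by
      simp only [hT, hR]
      split_ifs with h
      · rw [mul_zero, add_zero, norm_mul, RCLike.norm_ofReal, abs_of_pos (by norm_num)]
        simp only [norm_zero]; apply le_of_eq; ring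
      · rw [mul_zero, zero_add, norm_mul, ha, one_mul]
        linarith [sq_nonneg ‖S i ω‖]
    refine (Finset.sum_le_sum fun ω _ => this ω).trans ?_
    rw [Finset.sum_add_distrib, ← Finset.sum_div]
    linarith [hS2 i, hRsum i]
  have hTq : |gramForm A T| ≤ N * (192 * c) := by
    refine (Finset.abs_sum_le_sum_abs _ _).trans ?_
    refine (Finset.sum_le_sum (g := fun _ => 192 * c) fun ω _ => ?_).trans (by simp [hN])
    have hs : (√192 : ℝ) ^ 2 = 192 := Real.sq_sqrt (by norm_num)
    have hs0 : (0 : ℝ) < √192 := by positivity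
    have h := hc (fun i => (((√192)⁻¹ : ℝ) : 𝕜) * T i ω) fun i => by
      rw [norm_mul, RCLike.norm_ofReal, abs_of_pos (inv_pos.2 hs0), inv_mul_le_iff₀ hs0, mul_one]
      apply Real.le_sqrt_of_sq_le
      simp only [hT]
      split_ifs with h
      · exact h
      · simp
    rw [quadForm_smul, inv_pow, hs, abs_mul, abs_of_pos (by norm_num),
      inv_mul_le_iff₀ (by norm_num)] at h
    exact h
  have hb := fun {s : ℝ} (hs : 0 < s) V hV => abs_gramForm_le_mul (hC Ω) (s := s) hs V hV
  have h1 := hb (by positivity) R hRsum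
  have h2 := hb (by positivity) _ (hmix 1 (by simp))
  have h3 := hb (by positivity) _ (hmix (-1) (by simp))
  have hsplit : N * gramForm A U = gramForm A T + gramForm A R
      + 4 * (gramForm A (fun i ω => ((1 / 8 : ℝ) : 𝕜) * T i ω + 1 * R i ω)
        - gramForm A (fun i ω => ((1 / 8 : ℝ) : 𝕜) * T i ω + -1 * R i ω)) := by
    rw [hN, ← gramForm_signs he]
    change ∑ ω, quadForm A (fun i => S i ω) = _
    simp only [gramForm, Finset.mul_sum, ← Finset.sum_add_distrib, ← Finset.sum_sub_distrib]
    refine Finset.sum_congr rfl fun ω _ => ?_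
    simp only [hTR, one_mul, neg_one_mul, ← sub_eq_add_neg]
    exact quadForm_add_split A _ _
  rw [← mul_le_mul_iff_right₀ hN0, ← abs_of_pos hN0, ← abs_mul, abs_of_pos hN0, hsplit]
  rw [abs_le] at *
  -- The coefficient of `C` is 1/64 from the tail plus 4 · 2/32 from the cross terms, that is 17/64.
  constructor <;> nlinarith

/-- **Grothendieck's inequality** for the quadratic form of a matrix on unit balls. -/
theorem abs_gramForm_le_of_abs_quadForm_le {A : Matrix (Fin n) (Fin n) 𝕜} {c : ℝ}
    (hc : ∀ x : Fin n → 𝕜, (∀ i, ‖x i‖ ≤ 1) → |quadForm A x| ≤ c)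
    {ι : Type} [Fintype ι] (U : Fin n → ι → 𝕜) (hU : ∀ i, ∑ ω, ‖U i ω‖ ^ 2 ≤ 1) :
    |gramForm A U| ≤ 300 * c := by
  -- All finite index types are allowed at once, because truncation replaces `Fin d` by `Ω`.
  set s : Set ℝ := {t | ∃ (ι : Type) (_ : Fintype ι) (U : Fin n → ι → 𝕜),
    (∀ i, ∑ ω, ‖U i ω‖ ^ 2 ≤ 1) ∧ t = |gramForm A U|} with hs
  have hbdd : BddAbove s := ⟨∑ i, ∑ j, ‖A i j‖, by
    rintro _ ⟨ι, _, U, hU, rfl⟩; exact abs_gramForm_le A U hU⟩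
  have hC : ∀ (ι : Type) [Fintype ι] (U : Fin n → ι → 𝕜), (∀ i, ∑ ω, ‖U i ω‖ ^ 2 ≤ 1) →
      |gramForm A U| ≤ sSup s := fun ι _ U hU => le_csSup hbdd ⟨ι, _, U, hU, rfl⟩
  have hle : sSup s ≤ 192 * c + 17 / 64 * sSup s := by
    refine csSup_le ⟨_, ι, _, U, hU, rfl⟩ ?_
    rintro _ ⟨κ, _, V, hV, rfl⟩
    rw [← gramForm_comp_equiv A V (Fintype.equivFin κ).symm]
    refine abs_gramForm_le_of_apriori hc hC _ fun i => ?_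
    rw [Equiv.sum_comp (Fintype.equivFin κ).symm fun ω => ‖V i ω‖ ^ 2]
    exact hV i
  have := hC ι U hU
  have hc0 : 0 ≤ c := (abs_nonneg _).trans (hc 0 (by simp))
  -- Absorption gives 192 · 64/47 < 300.
  linarith

/-! ### Grothendieck's inequality on spheres -/

/-- For a matrix with zero diagonal, a bound for the quadratic form on the torus extends to the
polydisc. -/
lemma abs_quadForm_le_of_diag_eq_zero {B : Matrix (Fin n) (Fin n) 𝕜} (hB : ∀ i, B i i = 0) {c : ℝ}
    (hc : ∀ x : Fin n → 𝕜, (∀ i, ‖x i‖ = 1) → |quadForm B x| ≤ c)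
    (x : Fin n → 𝕜) (hx : ∀ i, ‖x i‖ ≤ 1) : |quadForm B x| ≤ c := by
  suffices h : ∀ (s : Finset (Fin n)) (x : Fin n → 𝕜), (∀ i, ‖x i‖ ≤ 1) →
      (∀ i ∉ s, ‖x i‖ = 1) → |quadForm B x| ≤ c from h Finset.univ x hx (by simp)
  intro s
  induction s using Finset.induction_on with
  | empty => exact fun x _ hx => hc x fun i => hx i (by simp)
  | insert k s _ ih =>
    intro x hx hxs
    obtain ⟨u, hu, hxu⟩ : ∃ u : 𝕜, ‖u‖ = 1 ∧ x k = (‖x k‖ : 𝕜) * u := by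
      rcases eq_or_ne (x k) 0 with h | h
      · exact ⟨1, by simp, by simp [h]⟩
      · refine ⟨x k / (‖x k‖ : 𝕜), by simp [h], ?_⟩
        field_simp
    set r := ‖x k‖ with hr
    have hr0 : 0 ≤ r := norm_nonneg _
    have hr1 : r ≤ 1 := hx k
    have hbound : ∀ v : 𝕜, ‖v‖ = 1 → |quadForm B (Function.update x k v)| ≤ c := fun v hv => by
      refine ih _ (fun i => ?_) fun i hi => ?_
      · rcases eq_or_ne i k with rfl | h
        · simp [hv]
        · simpa [h] using hx i
      · rcases eq_or_ne i k with rfl | h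
        · simp [hv]
        · simpa [h] using hxs i (by simp [h, hi])
    -- `x k = r * u` lies on the segment from `-u` to `u`. The form is affine along it, since its
    -- quadratic term is the vanishing diagonal entry (`hz`).
    have hcomb := quadForm_convex_combination B ((1 + r) / 2) ((1 - r) / 2) (by ring)
      (Function.update x k u) (Function.update x k (-u))
    have hz : quadForm B (fun i => Function.update x k u i - Function.update x k (-u) i) = 0 := by
      rw [quadForm_eq_sum]
      refine Finset.sum_eq_zero fun i _ => Finset.sum_eq_zero fun j _ => ?_
      rcases eq_or_ne i k with rfl | h
      · rcases eq_or_ne j i with rfl | h'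
        · simp [hB]
        · simp [h']
      · simp [h]
    have hxe : (fun i => (((1 + r) / 2 : ℝ) : 𝕜) * Function.update x k u i
        + (((1 - r) / 2 : ℝ) : 𝕜) * Function.update x k (-u) i) = x := by
      funext i
      rcases eq_or_ne i k with rfl | h
      · rw [Function.update_self, Function.update_self, hxu]
        push_cast; ring
      · rw [Function.update_of_ne h, Function.update_of_ne h]
        push_cast; ring
    rw [hxe, hz] at hcomb
    have h1 := hbound u hu
    have h2 := hbound (-u) (by simpa using hu)
    rw [hcomb]
    rw [abs_le] at *
    constructor <;> nlinarith

/-- The sum of the diagonal is an average of values of the quadratic form on the torus. -/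
lemma abs_trace_le {A : Matrix (Fin n) (Fin n) 𝕜} {c : ℝ}
    (hc : ∀ x : Fin n → 𝕜, (∀ i, ‖x i‖ = 1) → |quadForm A x| ≤ c) :
    |∑ i, RCLike.re (A i i)| ≤ c := by
  obtain ⟨Ω, _, _, e, h1, he, -⟩ := exists_signs 𝕜 n
  have hN0 : (0 : ℝ) < Fintype.card Ω := by simp [Fintype.card_pos]
  have h := gramForm_signs he A fun i k => if i = k then 1 else 0
  have hd : gramForm A (fun i k => if i = k then (1 : 𝕜) else 0) = ∑ i, RCLike.re (A i i) := by
    rw [gramForm_eq_sum]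
    refine Finset.sum_congr rfl fun i _ => ?_
    rw [Finset.sum_eq_single i (fun j _ hj => by simp [hj.symm]) (by simp)]
    simp
  -- For the standard basis, the sign sums are the signs themselves, hence points of the torus.
  simp only [ite_mul, one_mul, zero_mul, Finset.sum_ite_eq, Finset.mem_univ, if_true] at h
  rw [hd] at h
  rw [← mul_le_mul_iff_right₀ hN0, ← abs_of_pos hN0, ← abs_mul, abs_of_pos hN0, ← h]
  refine (Finset.abs_sum_le_sum_abs _ _).trans ?_
  refine (Finset.sum_le_sum (g := fun _ => c) fun ω _ => hc _ fun i => h1 i ω).trans (by simp)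

/-- **Grothendieck's inequality** for the quadratic form of a matrix on unit spheres. -/
theorem abs_gramForm_le_of_abs_quadForm_le_sphere {A : Matrix (Fin n) (Fin n) 𝕜} {c : ℝ}
    (hc : ∀ x : Fin n → 𝕜, (∀ i, ‖x i‖ = 1) → |quadForm A x| ≤ c)
    {ι : Type} [Fintype ι] (U : Fin n → ι → 𝕜) (hU : ∀ i, ∑ ω, ‖U i ω‖ ^ 2 = 1) :
    |gramForm A U| ≤ 601 * c := by
  set B : Matrix (Fin n) (Fin n) 𝕜 := A - diagonal fun i => A i i with hB
  have ht := abs_trace_le hc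
  have hdiag : ∀ {κ : Type} [Fintype κ] (V : Fin n → κ → 𝕜), (∀ i, ∑ ω, ‖V i ω‖ ^ 2 = 1) →
      gramForm (diagonal fun i => A i i) V = ∑ i, RCLike.re (A i i) := fun V hV => by
    rw [gramForm_eq_sum]
    refine Finset.sum_congr rfl fun i _ => ?_
    rw [Finset.sum_eq_single i (fun j _ hj => by simp [diagonal_apply_ne' _ hj]) (by simp)]
    have : ∑ ω, star (V i ω) * V i ω = ((∑ ω, ‖V i ω‖ ^ 2 : ℝ) : 𝕜) := by
      simp [RCLike.conj_mul]
    rw [this, hV i]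
    simp
  have hBq : ∀ x : Fin n → 𝕜, (∀ i, ‖x i‖ = 1) → |quadForm B x| ≤ 2 * c := fun x hx => by
    have h1 := hc x hx
    have h2 := hdiag (fun i (_ : Unit) => x i) fun i => by simp [hx i]
    simp only [gramForm, Finset.univ_unique, Finset.sum_const, Finset.card_singleton,
      one_smul] at h2
    rw [hB, quadForm_sub, h2]
    rw [abs_le] at *
    constructor <;> linarith
  have h := abs_gramForm_le_of_abs_quadForm_le
    (abs_quadForm_le_of_diag_eq_zero (B := B) (fun i => by simp [hB]) hBq) U fun i => (hU i).le
  have hsub : gramForm B U = gramForm A U - ∑ i, RCLike.re (A i i) := by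
    rw [← hdiag U hU]
    simp only [gramForm, hB, quadForm_sub, Finset.sum_sub_distrib]
  rw [hsub] at h
  rw [abs_le] at *
  -- 601 = 300 · 2 + 1: the ball constant applied to `2 * c`, plus the trace.
  constructor <;> linarith

/-! ### Suprema and norm conditions -/

lemma sSup_le_iff_forall {α : Type*} {P : α → Prop} {f : α → ℝ} (hne : ∃ x, P x) {b : ℝ}
    (hb : ∀ x, P x → f x ≤ b) (c : ℝ) :
    sSup {t : ℝ | ∃ x, P x ∧ t = f x} ≤ c ↔ ∀ x, P x → f x ≤ c := by
  have hbdd : BddAbove {t : ℝ | ∃ x, P x ∧ t = f x} :=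
    ⟨b, by rintro _ ⟨x, hx, rfl⟩; exact hb x hx⟩
  obtain ⟨x₀, hx₀⟩ := hne
  rw [csSup_le_iff hbdd ⟨f x₀, x₀, hx₀, rfl⟩]
  exact ⟨fun h x hx => h _ ⟨x, hx, rfl⟩, by rintro h _ ⟨x, hx, rfl⟩; exact h x hx⟩

lemma max_sSup_le_iff_forall {α : Type*} {P : α → Prop} {f g : α → ℝ} (hfg : ∀ x, g x = -f x)
    (hne : ∃ x, P x) {b : ℝ} (hb : ∀ x, P x → |f x| ≤ b) (c : ℝ) :
    max (sSup {t : ℝ | ∃ x, P x ∧ t = f x}) (sSup {t : ℝ | ∃ x, P x ∧ t = g x}) ≤ c ↔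
      ∀ x, P x → |f x| ≤ c := by
  rw [max_le_iff, sSup_le_iff_forall hne fun x hx => (abs_le.1 (hb x hx)).2,
    sSup_le_iff_forall hne (b := b) fun x hx => by rw [hfg]; linarith [(abs_le.1 (hb x hx)).1],
    ← forall_and]
  refine forall_congr' fun x => ?_
  rw [← imp_and, hfg, abs_le']

/-- A condition on the norm of a vector which is either `‖x‖ = 1` or `‖x‖ ≤ 1`; only the following
properties of these conditions matter. -/
structure NormCondition (p : ℝ → Prop) : Prop where
  one : p 1
  le_one : ∀ t, p t → t ≤ 1
  sq_iff : ∀ t, 0 ≤ t → (p (t ^ 2) ↔ p t)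

lemma normCondition_eq : NormCondition (· = 1) :=
  ⟨rfl, fun _ h => h.le, fun _ ht => pow_eq_one_iff_of_nonneg ht two_ne_zero⟩

lemma normCondition_le : NormCondition (· ≤ 1) :=
  ⟨le_rfl, fun _ h => h, fun _ ht => sq_le_one_iff₀ ht⟩

/-- Supremum of the quadratic form over vectors whose entries satisfy a norm condition. -/
noncomputable def qSup (p : ℝ → Prop) (A : Matrix (Fin n) (Fin n) 𝕜) : ℝ :=
  sSup {t : ℝ | ∃ x : Fin n → 𝕜, (∀ i, p ‖x i‖) ∧ t = quadForm A x}

/-- Supremum of `gramForm A` over square matrices whose rows satisfy a norm condition. -/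
noncomputable def gramSup (p : ℝ → Prop) (A : Matrix (Fin n) (Fin n) 𝕜) : ℝ :=
  sSup {t : ℝ | ∃ U : Fin n → Fin n → 𝕜, (∀ i, p (∑ ω, ‖U i ω‖ ^ 2)) ∧ t = gramForm A U}

/-- Common generalization of `gammaNorm` and `GammaNorm`. -/
noncomputable def vecNorm (p : ℝ → Prop) (d : ℕ) (A : Matrix (Fin n) (Fin n) 𝕜) : ℝ :=
  sSup {t : ℝ | ∃ x : Fin n → EuclideanSpace 𝕜 (Fin d), (∀ i, p ‖x i‖) ∧
    t = ‖∑ i, ∑ j, A i j * inner 𝕜 (x i) (x j)‖}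

/-- Common generalization of `thetaNorm` and `ThetaNorm`. -/
noncomputable def scalarNorm (p : ℝ → Prop) (A : Matrix (Fin n) (Fin n) 𝕜) : ℝ :=
  sSup {t : ℝ | ∃ δ : Fin n → 𝕜, (∀ i, p ‖δ i‖) ∧
    t = ‖∑ i, ∑ j, A i j * (star (δ i) * δ j)‖}

variable (𝕜) in
/-- Common generalization of `Kgamma` and `KGamma`. -/
noncomputable def grothendieckConst (p : ℝ → Prop) : ℝ :=
  sInf {K : ℝ | ∀ n d : ℕ, n ≤ d → ∀ A : Matrix (Fin n) (Fin n) 𝕜, A.IsHermitian →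
    vecNorm p d A ≤ K * scalarNorm p A}

/-! ### Semidefinite matrices as Gram matrices -/

lemma re_trace_mul_gram {ι : Type*} [Fintype ι] (A : Matrix (Fin n) (Fin n) 𝕜)
    (U : Matrix (Fin n) ι 𝕜) : RCLike.re (A * (U * Uᴴ)).trace = gramForm A U := by
  refine Eq.trans ?_ (gramForm_eq_sum A fun i ω => U i ω).symm
  simp only [trace, diag_apply, mul_apply, conjTranspose_apply, map_sum]
  refine Finset.sum_congr rfl fun i _ => Finset.sum_congr rfl fun j _ => ?_
  congr 2
  exact Finset.sum_congr rfl fun ω _ => mul_comm _ _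

lemma gram_diag {ι : Type*} [Fintype ι] (U : Matrix (Fin n) ι 𝕜) (i : Fin n) :
    (U * Uᴴ) i i = ((∑ ω, ‖U i ω‖ ^ 2 : ℝ) : 𝕜) := by
  simp [mul_apply, RCLike.mul_conj]

lemma _root_.Matrix.PosSemidef.exists_eq_mul_conjTranspose {X : Matrix (Fin n) (Fin n) 𝕜}
    (hX : X.PosSemidef) : ∃ U : Matrix (Fin n) (Fin n) 𝕜, X = U * Uᴴ := by
  open scoped MatrixOrder Matrix.Norms.L2Operator in
  obtain ⟨B, hB⟩ := CStarAlgebra.nonneg_iff_eq_star_mul_self.mp hX.nonneg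
  exact ⟨Bᴴ, by rw [hB, conjTranspose_conjTranspose]; rfl⟩

lemma rEq_eq_gramSup (A : Matrix (Fin n) (Fin n) 𝕜) : rEq A = gramSup (· = 1) A := by
  refine congrArg sSup (Set.ext fun t => ⟨?_, ?_⟩)
  · rintro ⟨X, hX, hd, rfl⟩
    obtain ⟨U, rfl⟩ := hX.exists_eq_mul_conjTranspose
    refine ⟨U, fun i => ?_, re_trace_mul_gram A U⟩
    have := hd i
    rw [gram_diag] at this
    exact_mod_cast this
  · rintro ⟨U, hU, rfl⟩
    refine ⟨of U * (of U)ᴴ, posSemidef_self_mul_conjTranspose _, fun i => ?_,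
      (re_trace_mul_gram A _).symm⟩
    rw [gram_diag]
    exact_mod_cast hU i

lemma rLe_eq_gramSup (A : Matrix (Fin n) (Fin n) 𝕜) : rLe A = gramSup (· ≤ 1) A := by
  refine congrArg sSup (Set.ext fun t => ⟨?_, ?_⟩)
  · rintro ⟨X, hX, hd, rfl⟩
    obtain ⟨U, rfl⟩ := hX.exists_eq_mul_conjTranspose
    refine ⟨U, fun i => ?_, re_trace_mul_gram A U⟩
    have := hd i
    rwa [gram_diag, RCLike.ofReal_re] at this
  · rintro ⟨U, hU, rfl⟩
    refine ⟨of U * (of U)ᴴ, posSemidef_self_mul_conjTranspose _, fun i => ?_,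
      (re_trace_mul_gram A _).symm⟩
    rw [gram_diag, RCLike.ofReal_re]
    exact hU i

/-- Gram matrices of `n` vectors are Gram matrices of vectors in an `n`-dimensional space. -/
lemma exists_square_gram {ι : Type*} [Fintype ι] (U : Fin n → ι → 𝕜) :
    ∃ V : Fin n → Fin n → 𝕜, (∀ i, ∑ ω, ‖V i ω‖ ^ 2 = ∑ ω, ‖U i ω‖ ^ 2) ∧
      ∀ A : Matrix (Fin n) (Fin n) 𝕜, gramForm A V = gramForm A U := by
  obtain ⟨V, hV⟩ := (posSemidef_self_mul_conjTranspose (of U)).exists_eq_mul_conjTranspose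
  refine ⟨V, fun i => ?_, fun A => ?_⟩
  · have := congrFun (congrFun hV i) i
    rw [gram_diag, gram_diag] at this
    exact_mod_cast this.symm
  · rw [← re_trace_mul_gram, ← hV, re_trace_mul_gram]
    rfl

/-! ### Comparison of the norms and sharpness -/

section NormCondition

variable {p : ℝ → Prop}

lemma max_qSup_le_iff (hp : NormCondition p) (A : Matrix (Fin n) (Fin n) 𝕜) (c : ℝ) :
    max (qSup p A) (qSup p (-A)) ≤ c ↔
      ∀ x : Fin n → 𝕜, (∀ i, p ‖x i‖) → |quadForm A x| ≤ c := by
  refine max_sSup_le_iff_forall (fun x => quadForm_neg A x) ⟨fun _ => 1, by simp [hp.one]⟩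
    (b := ∑ i, ∑ j, ‖A i j‖) (fun x hx => ?_) c
  have := abs_gramForm_le A (fun i (_ : Unit) => x i) fun i => by
    simpa using hp.le_one _ (hx i)
  simpa [gramForm] using this

lemma max_gramSup_le_iff (hp : NormCondition p) (A : Matrix (Fin n) (Fin n) 𝕜) (c : ℝ) :
    max (gramSup p A) (gramSup p (-A)) ≤ c ↔
      ∀ U : Fin n → Fin n → 𝕜, (∀ i, p (∑ ω, ‖U i ω‖ ^ 2)) → |gramForm A U| ≤ c := by
  refine max_sSup_le_iff_forall (fun U => by simp [gramForm, quadForm_neg])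
    ⟨fun i j => if i = j then 1 else 0, fun i => ?_⟩
    (fun U hU => abs_gramForm_le A U fun i => hp.le_one _ (hU i)) c
  rw [Finset.sum_eq_single i (fun j _ hj => by simp [hj.symm]) (by simp)]
  simp [hp.one]

lemma abs_gramForm_le_max_gramSup (hp : NormCondition p) {ι : Type*} [Fintype ι] (A : Matrix (Fin n) (Fin n) 𝕜)
    (U : Fin n → ι → 𝕜) (hU : ∀ i, p (∑ ω, ‖U i ω‖ ^ 2)) :
    |gramForm A U| ≤ max (gramSup p A) (gramSup p (-A)) := by
  obtain ⟨V, hV, hA⟩ := exists_square_gram U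
  rw [← hA]
  exact (max_gramSup_le_iff hp A _).1 le_rfl V fun i => by rw [hV]; exact hU i

/-- Hermitian symmetry makes each `x* A x` real, so passing to real parts loses nothing. -/
lemma norm_sum_eq_abs_gramForm {A : Matrix (Fin n) (Fin n) 𝕜} (hA : A.IsHermitian) {ι : Type*}
    [Fintype ι] (U : Fin n → ι → 𝕜) :
    ‖∑ i, ∑ j, A i j * ∑ ω, star (U i ω) * U j ω‖ = |gramForm A U| := by
  have h : ∑ i, ∑ j, A i j * ∑ ω, star (U i ω) * U j ω
      = ∑ ω, (star fun i => U i ω) ⬝ᵥ A.mulVec fun i => U i ω := by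
    simp only [dotProduct, mulVec, Finset.mul_sum, Pi.star_apply]
    rw [Finset.sum_comm (s := Finset.univ (α := ι))]
    refine Finset.sum_congr rfl fun i _ => ?_
    rw [Finset.sum_comm]
    refine Finset.sum_congr rfl fun ω _ => Finset.sum_congr rfl fun j _ => ?_
    ring
  have him : ∀ ω, (((quadForm A fun i => U i ω : ℝ)) : 𝕜)
      = (star fun i => U i ω) ⬝ᵥ A.mulVec fun i => U i ω := fun ω =>
    RCLike.conj_eq_iff_re.1 (RCLike.conj_eq_iff_im.2 (hA.im_star_dotProduct_mulVec_self _))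
  rw [h, ← Finset.sum_congr rfl fun ω _ => him ω, ← RCLike.ofReal_sum, RCLike.norm_ofReal]
  rfl

lemma scalarNorm_eq_max_qSup (hp : NormCondition p) {A : Matrix (Fin n) (Fin n) 𝕜} (hA : A.IsHermitian) :
    scalarNorm p A = max (qSup p A) (qSup p (-A)) := by
  have key : ∀ x : Fin n → 𝕜, ‖∑ i, ∑ j, A i j * (star (x i) * x j)‖ = |quadForm A x| :=
    fun x => by
      have := norm_sum_eq_abs_gramForm hA fun i (_ : Unit) => x i
      simpa [gramForm] using this
  refine eq_of_forall_ge_iff fun c => ?_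
  rw [max_qSup_le_iff hp]
  simp only [scalarNorm, key]
  exact sSup_le_iff_forall ⟨fun _ => 1, by simp [hp.one]⟩
    (fun x hx => (max_qSup_le_iff hp A _).1 le_rfl x hx) c

lemma vecNorm_le_iff (hp : NormCondition p) {A : Matrix (Fin n) (Fin n) 𝕜} (hA : A.IsHermitian) {d : ℕ} (hd : n ≤ d)
    (c : ℝ) : vecNorm p d A ≤ c ↔
      ∀ U : Fin n → Fin d → 𝕜, (∀ i, p (∑ ω, ‖U i ω‖ ^ 2)) → |gramForm A U| ≤ c := by
  have key : ∀ x : Fin n → EuclideanSpace 𝕜 (Fin d),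
      ‖∑ i, ∑ j, A i j * inner 𝕜 (x i) (x j)‖ = |gramForm A fun i ω => x i ω| := fun x => by
    rw [← norm_sum_eq_abs_gramForm hA]
    simp [PiLp.inner_apply, RCLike.inner_apply, mul_comm]
  have hcond : ∀ (x : EuclideanSpace 𝕜 (Fin d)), p (∑ ω, ‖x ω‖ ^ 2) ↔ p ‖x‖ := fun x => by
    rw [← hp.sq_iff _ (norm_nonneg x), EuclideanSpace.norm_sq_eq]
  simp only [vecNorm, key]
  rw [sSup_le_iff_forall (b := max (gramSup p A) (gramSup p (-A)))]
  · constructor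
    · intro h U hU
      exact h (fun i => WithLp.toLp 2 (U i)) fun i => (hcond _).1 (hU i)
    · exact fun h x hx => h _ fun i => (hcond _).2 (hx i)
  · refine ⟨fun i => EuclideanSpace.single ⟨i, i.2.trans_le hd⟩ 1, fun i => ?_⟩
    simp [hp.one]
  · exact fun x hx => abs_gramForm_le_max_gramSup hp A _ fun i => (hcond _).2 (hx i)

lemma vecNorm_le_max_gramSup (hp : NormCondition p) {A : Matrix (Fin n) (Fin n) 𝕜} (hA : A.IsHermitian) {d : ℕ}
    (hd : n ≤ d) : vecNorm p d A ≤ max (gramSup p A) (gramSup p (-A)) :=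
  (vecNorm_le_iff hp hA hd _).2 fun U hU => abs_gramForm_le_max_gramSup hp A U hU

lemma max_gramSup_eq_vecNorm (hp : NormCondition p) {A : Matrix (Fin n) (Fin n) 𝕜} (hA : A.IsHermitian) :
    max (gramSup p A) (gramSup p (-A)) = vecNorm p n A :=
  eq_of_forall_ge_iff fun c => by rw [max_gramSup_le_iff hp, vecNorm_le_iff hp hA le_rfl]

lemma max_qSup_le_max_gramSup (hp : NormCondition p) (A : Matrix (Fin n) (Fin n) 𝕜) :
    max (qSup p A) (qSup p (-A)) ≤ max (gramSup p A) (gramSup p (-A)) :=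
  (max_qSup_le_iff hp A _).2 fun x hx => by
    have := abs_gramForm_le_max_gramSup hp A (fun i (_ : Unit) => x i) fun i => by
      simpa using (hp.sq_iff _ (norm_nonneg _)).2 (hx i)
    simpa [gramForm] using this

/-- The two inequalities and the sharpness of the constant, for a norm condition for which
Grothendieck's inequality holds with some constant. -/
theorem grothendieckConst_sharp (hp : NormCondition p) {K₀ : ℝ}
    (hK₀ : ∀ (n : ℕ) (A : Matrix (Fin n) (Fin n) 𝕜) (c : ℝ),
      (∀ x : Fin n → 𝕜, (∀ i, p ‖x i‖) → |quadForm A x| ≤ c) →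
      ∀ U : Fin n → Fin n → 𝕜, (∀ i, p (∑ ω, ‖U i ω‖ ^ 2)) → |gramForm A U| ≤ K₀ * c) :
    (∀ (n : ℕ) (A : Matrix (Fin n) (Fin n) 𝕜), A.IsHermitian →
      max (gramSup p A) (gramSup p (-A)) ≤
        grothendieckConst 𝕜 p * max (qSup p A) (qSup p (-A))) ∧
    (∀ K : ℝ, (∀ (n : ℕ) (A : Matrix (Fin n) (Fin n) 𝕜), A.IsHermitian →
      max (gramSup p A) (gramSup p (-A)) ≤ K * max (qSup p A) (qSup p (-A))) →
        grothendieckConst 𝕜 p ≤ K) := by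
  have hset : ∀ K : ℝ, (∀ (n : ℕ) (A : Matrix (Fin n) (Fin n) 𝕜), A.IsHermitian →
      max (gramSup p A) (gramSup p (-A)) ≤ K * max (qSup p A) (qSup p (-A))) ↔
      K ∈ {K : ℝ | ∀ n d : ℕ, n ≤ d → ∀ A : Matrix (Fin n) (Fin n) 𝕜, A.IsHermitian →
        vecNorm p d A ≤ K * scalarNorm p A} := fun K => by
    constructor
    · intro h n d hd A hA
      rw [scalarNorm_eq_max_qSup hp hA]
      exact (vecNorm_le_max_gramSup hp hA hd).trans (h n A hA)
    · intro h n A hA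
      rw [← scalarNorm_eq_max_qSup hp hA, max_gramSup_eq_vecNorm hp hA]
      exact h n n le_rfl A hA
  have hbdd : BddBelow {K : ℝ | ∀ n d : ℕ, n ≤ d → ∀ A : Matrix (Fin n) (Fin n) 𝕜,
      A.IsHermitian → vecNorm p d A ≤ K * scalarNorm p A} := by
    refine ⟨1, fun K hK => ?_⟩
    -- The 1 × 1 identity has a positive scalar maximum, which forces `1 ≤ K`.
    have h := (hset K).2 hK 1 1 isHermitian_one
    have h1 := max_qSup_le_max_gramSup hp (1 : Matrix (Fin 1) (Fin 1) 𝕜)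
    have h2 := (max_qSup_le_iff hp (1 : Matrix (Fin 1) (Fin 1) 𝕜) _).1 le_rfl (fun _ => 1)
      (by simp [hp.one])
    have h3 : quadForm (1 : Matrix (Fin 1) (Fin 1) 𝕜) (fun _ => 1) = 1 := by
      simp [quadForm_eq_sum]
    rw [h3, abs_one] at h2
    nlinarith
  have hmem : K₀ ∈ {K : ℝ | ∀ n d : ℕ, n ≤ d → ∀ A : Matrix (Fin n) (Fin n) 𝕜,
      A.IsHermitian → vecNorm p d A ≤ K * scalarNorm p A} :=
    (hset K₀).1 fun n A _ => (max_gramSup_le_iff hp A _).2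
      (hK₀ n A _ ((max_qSup_le_iff hp A _).1 le_rfl))
  refine ⟨fun n A hA => ?_, fun K hK => csInf_le hbdd ((hset K).1 hK)⟩
  have hq : 0 ≤ max (qSup p A) (qSup p (-A)) :=
    (abs_nonneg _).trans ((max_qSup_le_iff hp A _).1 le_rfl (fun _ => 1) (by simp [hp.one]))
  -- If the scalar maximum vanishes, every constant gives the same bound 0, so `K₀` serves;
  -- otherwise divide by it and pass to the infimum.
  rcases hq.eq_or_lt with h0 | h0
  · have := (hset K₀).2 hmem n A hA
    rwa [← h0, mul_zero] at this ⊢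
  · rw [← div_le_iff₀ h0]
    refine le_csInf ⟨K₀, hmem⟩ fun K hK => ?_
    rw [div_le_iff₀ h0]
    exact (hset K).2 hK n A hA

end NormCondition

end

end SymGrothendieck

theorem theorem6p2 {𝕜 : Type*} [RCLike 𝕜] :
    (∀ (n : ℕ) (A : Matrix (Fin n) (Fin n) 𝕜), A.IsHermitian →
      (max (qEq A) (qEq (-A)) ≤ max (rEq A) (rEq (-A)) ∧
        max (rEq A) (rEq (-A)) ≤ Kgamma 𝕜 * max (qEq A) (qEq (-A))) ∧
      (max (qLe A) (qLe (-A)) ≤ max (rLe A) (rLe (-A)) ∧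
        max (rLe A) (rLe (-A)) ≤ KGamma 𝕜 * max (qLe A) (qLe (-A)))) ∧
    (∀ K : ℝ,
      (∀ (n : ℕ) (A : Matrix (Fin n) (Fin n) 𝕜), A.IsHermitian →
        max (rEq A) (rEq (-A)) ≤ K * max (qEq A) (qEq (-A))) → Kgamma 𝕜 ≤ K) ∧
    (∀ K : ℝ,
      (∀ (n : ℕ) (A : Matrix (Fin n) (Fin n) 𝕜), A.IsHermitian →
        max (rLe A) (rLe (-A)) ≤ K * max (qLe A) (qLe (-A))) → KGamma 𝕜 ≤ K) := by
  -- Only the semidefinite maxima need rewriting; the other quantities are instances of the general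
  -- ones by definition.
  simp only [rEq_eq_gramSup, rLe_eq_gramSup]
  obtain ⟨h1, h2⟩ := grothendieckConst_sharp (𝕜 := 𝕜) normCondition_eq
    fun n A c hc U hU => abs_gramForm_le_of_abs_quadForm_le_sphere hc U hU
  obtain ⟨h3, h4⟩ := grothendieckConst_sharp (𝕜 := 𝕜) normCondition_le
    fun n A c hc U hU => abs_gramForm_le_of_abs_quadForm_le hc U hU
  exact ⟨fun n A hA => ⟨⟨max_qSup_le_max_gramSup normCondition_eq A, h1 n A hA⟩,
    max_qSup_le_max_gramSup normCondition_le A, h3 n A hA⟩, h2, h4⟩
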